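/- Let $(V,\circ,e)$ be a finite-dimensional Euclidean Jordan algebra with identity $e$ (a real commutative algebra satisfying $x\circ(x^2\circ y)=x^2\circ(x\circ y)$ and admitting an associative positive definite bilinear form), of rank $r$. Every $x\in V$ has a spectral decomposition $x=\sum_{i=1}^r\lambda_i(x)c_i$ with $c_1,\dots,c_r$ a Jordan frame. Put $\mathrm{trace}(x)=\sum_i\lambda_i(x)$, $\langle x,y\rangle=\mathrm{trace}(x\circ y)$, $\|x\|_F=\sqrt{\langle x,x\rangle}$ and $\|x\|=\max_i|\lambda_i(x)|$. Let $\Omega=\mathrm{int}\{x^2:x\in V\}$, let $\bar\Omega$ be its closure, let $v^+$ be the projection of $v\in V$ onto $\bar\Omega$ with respect to $\|\cdot\|_F$, and let $\Delta(\Omega)=\{x\in\bar\Omega:\langle e,x\rangle=1\}$. Let $P:V\to V$ be the orthogonal projection, with respect to $\langle\cdot,\cdot\rangle$, onto a linear subspace $L\subseteq V$, and let $u:V\to\Delta(\Omega)$ be a mapping such that $u(v)\in\operatorname{argmin}_{w\in\Delta(\Omega)}\langle w,v\rangle$ for all $v\in V$. The von Neumann scheme starts from an arbitrary $z_0\in\Delta(\Omega)$.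 At the iterate $z_t$ it halts if $Pz_t\in\Omega$ or $\|(Pz_t)^+\|_F\le\frac1{4r}\|z_t\|$. Otherwise it performs one more iteration: it puts $u_t=u(Pz_t)$ and $$z_{t+1}=z_t+\theta_t(u_t-z_t),\qquad \theta_t\in\operatorname*{argmin}_{\theta\in[0,1]}\|P(z_t+\theta(u_t-z_t))\|_F^2 .$$ Proposition. If $t\ge1$ and the scheme performs $t$ iterations (that is, it does not halt at any of $z_0,\dots,z_{t-1}$), then $$\|Pz_t\|_F^2\le\frac1t .$$ -/

import Mathlib

namespace EuclideanJordan

/-- A commutative, unital, real algebra whose product is bilinear, satisfies the Jordan identity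
`(x * y) * (x * x) = x * (y * (x * x))`, and admits an associative positive definite bilinear form.
(Symmetry of the form is automatic: `B x y = B (1 * x) y = B 1 (x * y)`.) -/
class IsEuclideanJordanAlgebra (V : Type*) [NonAssocCommRing V] [Module ℝ V] : Prop
    extends IsCommJordan V, IsScalarTower ℝ V V, SMulCommClass ℝ V V where
  exists_form : ∃ B : LinearMap.BilinForm ℝ V,
    (∀ x y z : V, B (x * y) z = B x (y * z)) ∧ ∀ x : V, x ≠ 0 → 0 < B x x

section Algebra

variable {V : Type*} [NonAssocCommRing V]

/-- A nonzero idempotent that is not the sum of two other idempotents. -/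
def IsPrimitiveIdempotent (c : V) : Prop :=
  c ≠ 0 ∧ c * c = c ∧ ¬ ∃ a b : V, a * a = a ∧ b * b = b ∧ a ≠ c ∧ b ≠ c ∧ a + b = c

/-- A complete system of pairwise orthogonal nonzero primitive idempotents. -/
structure IsJordanFrame {m : ℕ} (c : Fin m → V) : Prop where
  primitive : ∀ i, IsPrimitiveIdempotent (c i)
  orthogonal : ∀ i j, i ≠ j → c i * c j = 0
  sum_eq_one : ∑ i, c i = 1

/-- Powers `x ^ k` in the Jordan algebra. -/
def jpow (x : V) : ℕ → V
  | 0 => 1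
  | k + 1 => x * jpow x k

end Algebra

noncomputable section

variable {V : Type*} [NonAssocCommRing V] [Module ℝ V]

/-- The Jordan algebra rank: the smallest `r` such that `1, x, …, x ^ r` are linearly dependent
for every `x`. -/
def rank (V : Type*) [NonAssocCommRing V] [Module ℝ V] : ℕ :=
  sInf {r : ℕ | ∀ x : V, ¬ LinearIndependent ℝ (fun k : Fin (r + 1) => jpow x k)}

/-- `x = ∑ i, l i • c i` is a spectral decomposition of `x`. -/
def IsSpectralDecomposition (x : V) (l : Fin (rank V) → ℝ) (c : Fin (rank V) → V) : Prop :=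
  IsJordanFrame c ∧ x = ∑ i, l i • c i

open Classical in
/-- The vector of eigenvalues of `x`, read off a spectral decomposition of `x`. In a
finite-dimensional Euclidean Jordan algebra such a decomposition always exists and its
coefficients are unique up to order, so symmetric functions of `eigenvalues x` do not depend on
the choice. -/
def eigenvalues (x : V) : Fin (rank V) → ℝ :=
  if h : ∃ l c, IsSpectralDecomposition x l c then h.choose else 0

/-- The sum of the eigenvalues. -/
def trace (x : V) : ℝ := ∑ i, eigenvalues x i

/-- The trace inner product. -/
def ip (x y : V) : ℝ := trace (x * y)

/-- The Frobenius norm. -/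
def frobNorm (x : V) : ℝ := √(ip x x)

/-- The operator norm: the largest absolute value of an eigenvalue (`Fin r → ℝ` carries the sup
norm). -/
def opNorm (x : V) : ℝ := ‖eigenvalues x‖

/-- `P` is the projection onto `L`, orthogonal for the trace inner product. -/
def IsOrthogonalProjection (L : Submodule ℝ V) (P : V →ₗ[ℝ] V) : Prop :=
  ∀ x, P x ∈ L ∧ ∀ y ∈ L, ip (x - P x) y = 0

variable [TopologicalSpace V]

/-- The interior `Ω` of the cone of squares. -/
def coneInt (V : Type*) [NonAssocCommRing V] [TopologicalSpace V] : Set V :=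
  interior {y : V | ∃ x : V, y = x * x}

open Classical in
/-- The projection `v⁺` of `v` on the closure of `Ω`: the point of that closed convex cone nearest
to `v` in the Frobenius norm. -/
def posProj (v : V) : V :=
  if h : ∃ w ∈ closure (coneInt V), ∀ w' ∈ closure (coneInt V), frobNorm (v - w) ≤ frobNorm (v - w')
  then h.choose else 0

/-- The spectraplex `Δ(Ω)`. -/
def spectraplex (V : Type*) [NonAssocCommRing V] [Module ℝ V] [TopologicalSpace V] : Set V :=
  {x : V | x ∈ closure (coneInt V) ∧ ip 1 x = 1}

/-- `u` maps every `v` to a minimizer of `⟨·, v⟩` over the spectraplex. -/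
def IsLinearMinimizationOracle (u : V → V) : Prop :=
  ∀ v, u v ∈ spectraplex V ∧ ∀ w ∈ spectraplex V, ip (u v) v ≤ ip w v

/-- The condition of the while loop at the iterate `z`: neither stopping criterion holds. -/
def Continues (P : V →ₗ[ℝ] V) (z : V) : Prop :=
  P z ∉ coneInt V ∧ 1 / (4 * (rank V : ℝ)) * opNorm z < frobNorm (posProj (P z))

/-- `θ` minimizes `‖P (z + θ (w - z))‖_F ^ 2` over `[0, 1]`. -/
def IsExactStep (P : V →ₗ[ℝ] V) (z w : V) (θ : ℝ) : Prop :=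
  θ ∈ Set.Icc (0 : ℝ) 1 ∧
    ∀ η ∈ Set.Icc (0 : ℝ) 1,
      frobNorm (P (z + θ • (w - z))) ^ 2 ≤ frobNorm (P (z + η • (w - z))) ^ 2

/-- `VonNeumannIterate P u t z`: some run of the von Neumann scheme with projection `P` and oracle
`u` carries out `t` iterations, and `z` is the resulting iterate `z_t`. An iteration is carried out
only if the scheme does not halt at the current iterate. -/
inductive VonNeumannIterate (P : V →ₗ[ℝ] V) (u : V → V) : ℕ → V → Prop
  | init (z₀ : V) (h : z₀ ∈ spectraplex V) : VonNeumannIterate P u 0 z₀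
  | step (t : ℕ) (z : V) (θ : ℝ) (hz : VonNeumannIterate P u t z) (hc : Continues P z)
      (hθ : IsExactStep P z (u (P z)) θ) :
      VonNeumannIterate P u (t + 1) (z + θ • (u (P z) - z))

end

end EuclideanJordan

/-! Put `a = ‖P z‖²`. As `P z` is not interior, it has an eigenvalue `≤ 0`; the idempotent of that
eigenvalue lies in the spectraplex, so the oracle point `u` has `⟨u, P z⟩ ≤ 0`
(`exists_mem_spectraplex_ip_nonpos`). Hence `⟨P u, P z⟩ ≤ 0`, while `‖P u‖ ≤ ‖u‖ ≤ 1`. The exact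
step is thus at least as good as the minimum `a / (1 + a)` of `(1 - η)² a + η²`: the reciprocal of
`‖P z‖²` grows by at least one, and `t * ‖P z_t‖² ≤ 1` by induction.

Most of the work is to show that the trace, defined by a chosen spectral decomposition, is linear.
Jordan frames exist because `L(x) : y ↦ x * y` is self-adjoint for an associative form and commutes
with every `L(x ^ n)` (`exists_jordanFrame`); some linear functional is `1` on every primitive
idempotent (`exists_linear_trace`). -/

namespace EuclideanJordan

/-! ### Polarized Jordan identities and power-associativity -/

section JordanIdentities

variable {V : Type*} [NonAssocCommRing V] [Module ℝ V] [IsEuclideanJordanAlgebra V]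

theorem jordan_identity_linearized (a b c w : V) :
    (2 : ℝ) • (a * (b * c * w) - b * c * (a * w) + (b * (c * a * w) - c * a * (b * w)) +
      (c * (a * b * w) - a * b * (c * w))) = 0 := by
  rw [two_smul, ← two_nsmul]
  exact DFunLike.congr_fun (two_nsmul_lie_lmul_lmul_add_add_eq_zero a b c) w

/-- Expresses `L(x²y)` through `L(x)`, `L(y)`, `L(x²)`, `L(xy)`. With `y = x ^ n` it is a recursion
for `L(x ^ (n + 2))`; with `x = y = c` idempotent it is the Peirce cubic. -/
theorem mul_sq_mul_linearized (x y z : V) :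
    z * (x * x * y) =
      x * x * (y * z) + (2 : ℝ) • (x * y * (x * z)) - (2 : ℝ) • (x * (y * (x * z))) := by
  have h := jordan_identity_linearized x x z y
  rw [mul_comm z x, mul_comm z y, mul_comm (x * z) y, mul_comm (x * z) (x * y)] at h
  rw [smul_eq_zero_iff_right two_ne_zero] at h
  rw [← sub_eq_zero, ← h]
  module

theorem mul_left_comm_sq (x z : V) : x * x * (x * z) = x * (x * x * z) :=
  IsJordan.lmul_lmul_comm_lmul x z

theorem sq_mul_jpow (x : V) (n : ℕ) : x * x * jpow x n = jpow x (n + 2) := by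
  induction n with
  | zero => simp [jpow]
  | succ n ih =>
    rw [jpow, mul_left_comm_sq, ih]
    rfl

/-- By the recursion, `L(x ^ (n + 2))` is a polynomial in operators already known to commute with
`L(x)`. -/
theorem jpow_mul_left_comm (x : V) : ∀ (n : ℕ) (z : V), jpow x n * (x * z) = x * (jpow x n * z)
  | 0, z => by simp [jpow]
  | 1, z => by simp [jpow]
  | n + 2, z => by
    have h0 := jpow_mul_left_comm x n
    have h1 := jpow_mul_left_comm x (n + 1)
    have e : ∀ w : V, jpow x (n + 2) * w = x * x * (jpow x n * w)
        + (2 : ℝ) • (jpow x (n + 1) * (x * w)) - (2 : ℝ) • (x * (jpow x n * (x * w))) := by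
      intro w
      rw [← sq_mul_jpow, mul_comm, mul_sq_mul_linearized]
      rfl
    rw [e, e, h0, mul_left_comm_sq, h1, h0, h0, mul_sub, mul_add, mul_smul_comm, mul_smul_comm, h1]

/-- The Peirce relation `2 L(c)³ - 3 L(c)² + L(c) = 0` for an idempotent `c`. -/
theorem peirce_cubic {c : V} (hc : c * c = c) (x : V) :
    (2 : ℝ) • (c * (c * (c * x))) = (3 : ℝ) • (c * (c * x)) - c * x := by
  have h := mul_sq_mul_linearized c c x
  rw [hc, hc, mul_comm x c] at h
  rw [← sub_eq_zero] at h ⊢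
  rw [← h]
  module

end JordanIdentities

/-- An associative positive definite bilinear form. -/
structure IsAssocForm {V : Type*} [NonAssocCommRing V] [Module ℝ V]
    (B : LinearMap.BilinForm ℝ V) : Prop where
  assoc : ∀ x y z : V, B (x * y) z = B x (y * z)
  pos : ∀ x : V, x ≠ 0 → 0 < B x x

/-! ### Positivity of multiplication by an idempotent -/

namespace IsAssocForm

variable {V : Type*} [NonAssocCommRing V] [Module ℝ V] {B : LinearMap.BilinForm ℝ V}

theorem symm (hB : IsAssocForm B) (x y : V) : B x y = B y x := by
  have h : ∀ x y : V, B x y = B 1 (x * y) := fun x y => by rw [← hB.assoc, one_mul]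
  rw [h, h y, mul_comm]

theorem mul_left (hB : IsAssocForm B) (a x y : V) : B (a * x) y = B x (a * y) := by
  rw [mul_comm a x, hB.assoc]

theorem nonneg (hB : IsAssocForm B) (x : V) : 0 ≤ B x x := by
  rcases eq_or_ne x 0 with rfl | h
  · simp
  · exact (hB.pos x h).le

theorem eq_zero (hB : IsAssocForm B) {x : V} (h : B x x = 0) : x = 0 := by
  by_contra hx
  exact (hB.pos x hx).ne' h

variable [IsEuclideanJordanAlgebra V]

/-- Multiplication by an idempotent is a nonnegative combination of squares of self-adjoint
operators, namely the Peirce projections. -/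
theorem idempotent_mul_eq (hB : IsAssocForm B) {c : V} (hc : c * c = c) (x : V) :
    B (c * x) x =
      B ((2 : ℝ) • (c * (c * x)) - c * x) ((2 : ℝ) • (c * (c * x)) - c * x) +
      (1 / 2) * B ((4 : ℝ) • (c * x) - (4 : ℝ) • (c * (c * x)))
        ((4 : ℝ) • (c * x) - (4 : ℝ) • (c * (c * x))) := by
  -- The right side is `12 L⁴ - 20 L³ + 9 L²` with `L = L(c)`; the cubic at `x` and at `c * x`
  -- reduces it to `L`.
  have p1 := congrArg (B x) (peirce_cubic hc x)
  have p2 := congrArg (B x) (peirce_cubic hc (c * x))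
  simp only [map_sub, map_smul, LinearMap.sub_apply, LinearMap.smul_apply, smul_eq_mul,
    hB.mul_left] at p1 p2 ⊢
  linarith

theorem idempotent_mul_nonneg (hB : IsAssocForm B) {c : V} (hc : c * c = c) (x : V) :
    0 ≤ B (c * x) x := by
  rw [hB.idempotent_mul_eq hc]
  have h1 := hB.nonneg ((2 : ℝ) • (c * (c * x)) - c * x)
  have h2 := hB.nonneg ((4 : ℝ) • (c * x) - (4 : ℝ) • (c * (c * x)))
  positivity

theorem idempotent_mul_eq_zero (hB : IsAssocForm B) {c : V} (hc : c * c = c) {x : V}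
    (hx : B (c * x) x = 0) : c * x = 0 := by
  rw [hB.idempotent_mul_eq hc] at hx
  have h1 := hB.nonneg ((2 : ℝ) • (c * (c * x)) - c * x)
  have h2 := hB.nonneg ((4 : ℝ) • (c * x) - (4 : ℝ) • (c * (c * x)))
  have e1 := hB.eq_zero (x := (2 : ℝ) • (c * (c * x)) - c * x) (by linarith)
  have e2 := hB.eq_zero (x := (4 : ℝ) • (c * x) - (4 : ℝ) • (c * (c * x))) (by linarith)
  calc c * x = ((2 : ℝ) • (c * (c * x)) - c * x) +
        (1 / 2 : ℝ) • ((4 : ℝ) • (c * x) - (4 : ℝ) • (c * (c * x))) := by module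
    _ = 0 := by rw [e1, e2]; simp

end IsAssocForm

/-- An operator that is self-adjoint for a positive definite form is diagonalizable. -/
theorem iSup_eigenspace_eq_top_of_selfAdjoint {S : Type*} [AddCommGroup S] [Module ℝ S]
    [FiniteDimensional ℝ S] (B : LinearMap.BilinForm ℝ S) (hs : ∀ x y, B x y = B y x)
    (hp : ∀ x, x ≠ 0 → 0 < B x x) (A : Module.End ℝ S) (hA : ∀ x y, B (A x) y = B x (A y)) :
    ⨆ μ, A.eigenspace μ = ⊤ := by
  have hn : ∀ x, 0 ≤ B x x := fun x => by
    rcases eq_or_ne x 0 with rfl | h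
    · simp
    · exact (hp x h).le
  let core : InnerProductSpace.Core ℝ S :=
    { inner := fun x y => B x y
      conj_inner_symm := fun x y => by simpa using hs y x
      re_inner_nonneg := fun x => by simpa using hn x
      add_left := fun x y z => by simp
      smul_left := fun x y r => by simp
      definite := fun x hx => by
        by_contra h
        exact (hp x h).ne' hx }
  let _ : NormedAddCommGroup S := core.toNormedAddCommGroup
  let _ : InnerProductSpace ℝ S := InnerProductSpace.ofCore core.toCore
  have hsym : LinearMap.IsSymmetric A := fun x y => hA x y
  exact Submodule.orthogonal_eq_bot_iff.mp hsym.orthogonalComplement_iSup_eigenspaces_eq_bot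

/-! ### Spectral theorem and existence of Jordan frames -/

section Spectral

/-- A complete system of pairwise orthogonal nonzero idempotents. -/
structure IsCompleteSystem {V : Type*} [NonAssocCommRing V] {n : ℕ} (c : Fin n → V) : Prop where
  ne_zero : ∀ i, c i ≠ 0
  idem : ∀ i, c i * c i = c i
  orthogonal : ∀ i j, i ≠ j → c i * c j = 0
  sum_eq_one : ∑ i, c i = 1

theorem IsJordanFrame.isCompleteSystem {V : Type*} [NonAssocCommRing V] {n : ℕ} {c : Fin n → V}
    (hc : IsJordanFrame c) : IsCompleteSystem c :=
  ⟨fun i => (hc.primitive i).1, fun i => (hc.primitive i).2.1, hc.orthogonal, hc.sum_eq_one⟩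

variable {V : Type*} [NonAssocCommRing V] [Module ℝ V] [IsEuclideanJordanAlgebra V]

namespace IsCompleteSystem

variable {n : ℕ} {c : Fin n → V}

theorem mul_sum (hc : IsCompleteSystem c) (j : Fin n) (l : Fin n → ℝ) :
    c j * ∑ i, l i • c i = l j • c j := by
  rw [Finset.mul_sum, Finset.sum_eq_single j]
  · rw [mul_smul_comm, hc.idem]
  · intro i _ hij
    rw [mul_smul_comm, hc.orthogonal j i hij.symm, smul_zero]
  · simp

theorem sum_mul_sum (hc : IsCompleteSystem c) (k l : Fin n → ℝ) :
    (∑ i, k i • c i) * ∑ i, l i • c i = ∑ i, (k i * l i) • c i := by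
  rw [Finset.sum_mul]
  refine Finset.sum_congr rfl fun j _ => ?_
  rw [smul_mul_assoc, hc.mul_sum, smul_smul]

theorem linearIndependent (hc : IsCompleteSystem c) : LinearIndependent ℝ c := by
  rw [Fintype.linearIndependent_iff]
  intro g hg j
  have h := hc.mul_sum j g
  rw [hg, mul_zero] at h
  exact (smul_eq_zero.mp h.symm).resolve_right (hc.ne_zero j)

theorem le_finrank [FiniteDimensional ℝ V] (hc : IsCompleteSystem c) :
    n ≤ Module.finrank ℝ V := by
  simpa using hc.linearIndependent.fintype_card_le_finrank

theorem jpow_sum (hc : IsCompleteSystem c) (l : Fin n → ℝ) (k : ℕ) :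
    jpow (∑ i, l i • c i) k = ∑ i, l i ^ k • c i := by
  induction k with
  | zero => simp [jpow, hc.sum_eq_one]
  | succ k ih => rw [jpow, ih, hc.sum_mul_sum]; simp only [pow_succ']

end IsCompleteSystem

/-- The elements whose multiplication operator commutes with that of `x`. -/
def operatorCommutant (x : V) : Submodule ℝ V where
  carrier := {y | ∀ z, y * (x * z) = x * (y * z)}
  add_mem' := fun ha hb z => by rw [add_mul, ha z, hb z, add_mul, mul_add]
  zero_mem' := fun z => by simp
  smul_mem' := fun r a ha z => by rw [smul_mul_assoc, ha z, smul_mul_assoc, mul_smul_comm]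

theorem span_jpow_le_operatorCommutant (x : V) :
    Submodule.span ℝ (Set.range (jpow x)) ≤ operatorCommutant x := by
  rw [Submodule.span_le]
  rintro _ ⟨n, rfl⟩
  exact jpow_mul_left_comm x n

theorem mul_mem_span_jpow (x : V) {y : V} (hy : y ∈ Submodule.span ℝ (Set.range (jpow x))) :
    x * y ∈ Submodule.span ℝ (Set.range (jpow x)) := by
  induction hy using Submodule.span_induction with
  | mem y hy =>
    obtain ⟨n, rfl⟩ := hy
    exact Submodule.subset_span ⟨n + 1, rfl⟩
  | zero => simp
  | add a b _ _ ha hb => rw [mul_add]; exact add_mem ha hb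
  | smul r a _ ha => rw [mul_smul_comm]; exact Submodule.smul_mem _ r ha

variable (V) in
theorem exists_assocForm : ∃ B : LinearMap.BilinForm ℝ V, IsAssocForm B := by
  obtain ⟨B, h1, h2⟩ := IsEuclideanJordanAlgebra.exists_form (V := V)
  exact ⟨B, h1, h2⟩

/-- Splitting an idempotent of a complete system gives a longer complete system. -/
theorem IsCompleteSystem.exists_refinement {n : ℕ} {c : Fin n → V} (hc : IsCompleteSystem c)
    {i : Fin n} {a b : V} (ha : a * a = a) (hb : b * b = b) (ha' : a ≠ c i) (hb' : b ≠ c i)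
    (hab : a + b = c i) (l : Fin n → ℝ) :
    ∃ (c' : Fin (n + 1) → V) (l' : Fin (n + 1) → ℝ),
      IsCompleteSystem c' ∧ ∑ j, l j • c j = ∑ j, l' j • c' j := by
  obtain ⟨B, hB⟩ := exists_assocForm V
  have h0 : a * b = 0 := by
    have h := hc.idem i
    rw [← hab, add_mul, mul_add, mul_add, ha, hb, mul_comm b a] at h
    have h2 : (2 : ℝ) • (a * b) = 0 := by
      rw [← sub_eq_zero] at h
      rw [← h]; module
    exact (smul_eq_zero.mp h2).resolve_left two_ne_zero
  -- `B (c j) a` and `B (c j) b` are nonnegative with sum `B (c j) (c i) = 0`, so both vanish.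
  have hsumB : ∀ j, j ≠ i → c j * a = 0 ∧ c j * b = 0 := by
    intro j hj
    have hs : ∀ d : V, d * d = d → B (c j * d) d = B (c j) d := fun d hd => by
      rw [hB.assoc, hd]
    have h1 : B (c j) a + B (c j) b = 0 := by
      rw [← map_add, hab, ← hc.idem i, ← hB.assoc, hc.orthogonal j i hj]
      simp
    have h2 := hB.idempotent_mul_nonneg (hc.idem j) a
    have h3 := hB.idempotent_mul_nonneg (hc.idem j) b
    rw [hs a ha] at h2
    rw [hs b hb] at h3
    exact ⟨hB.idempotent_mul_eq_zero (hc.idem j) (by rw [hs a ha]; linarith),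
      hB.idempotent_mul_eq_zero (hc.idem j) (by rw [hs b hb]; linarith)⟩
  have ha0 : a ≠ 0 := fun h => hb' (by rw [← hab, h, zero_add])
  have hb0 : b ≠ 0 := fun h => ha' (by rw [← hab, h, add_zero])
  -- `a` takes slot `i` and `b` is prepended with the same coefficient. Constant `k = 1` gives
  -- completeness, `k = l` the expansion.
  have hu : ∀ k : Fin n → ℝ, k i • b + ∑ j, k j • Function.update c i a j = ∑ j, k j • c j := by
    intro k
    rw [← Finset.add_sum_erase _ _ (Finset.mem_univ i),
      ← Finset.add_sum_erase _ (fun j => k j • c j) (Finset.mem_univ i), Function.update_self,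
      ← hab, smul_add, ← add_assoc, add_comm (k i • b)]
    congr 1
    refine Finset.sum_congr rfl fun j hj => ?_
    rw [Function.update_of_ne (Finset.ne_of_mem_erase hj)]
  have hub : ∀ j, Function.update c i a j * b = 0 := by
    intro j
    rcases eq_or_ne j i with rfl | h
    · rw [Function.update_self, h0]
    · rw [Function.update_of_ne h, (hsumB j h).2]
  refine ⟨Fin.cons b (Function.update c i a), Fin.cons (l i) l, ⟨?_, ?_, ?_, ?_⟩, ?_⟩
  · refine Fin.cases (by simpa using hb0) fun j => ?_
    rw [Fin.cons_succ]
    rcases eq_or_ne j i with rfl | h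
    · rwa [Function.update_self]
    · rw [Function.update_of_ne h]
      exact hc.ne_zero j
  · refine Fin.cases (by simpa using hb) fun j => ?_
    rw [Fin.cons_succ]
    rcases eq_or_ne j i with rfl | h
    · rwa [Function.update_self]
    · rw [Function.update_of_ne h]
      exact hc.idem j
  · refine Fin.cases (Fin.cases (by simp) fun k _ => ?_) fun j =>
      Fin.cases (fun _ => ?_) fun k hjk => ?_
    · rw [Fin.cons_succ, Fin.cons_zero, mul_comm, hub]
    · rw [Fin.cons_succ, Fin.cons_zero, hub]
    · rw [Fin.cons_succ, Fin.cons_succ]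
      have hjk : j ≠ k := fun h => hjk (congrArg _ h)
      rcases eq_or_ne j i with rfl | h
      · rw [Function.update_self, Function.update_of_ne hjk.symm, mul_comm, (hsumB k hjk.symm).1]
      · rw [Function.update_of_ne h]
        rcases eq_or_ne k i with rfl | h'
        · rw [Function.update_self, (hsumB j h).1]
        · rw [Function.update_of_ne h', hc.orthogonal j k hjk]
  · rw [Fin.sum_univ_succ, Fin.cons_zero]
    simp only [Fin.cons_succ]
    simpa [hc.sum_eq_one] using hu fun _ => 1
  · rw [Fin.sum_univ_succ, Fin.cons_zero, Fin.cons_zero]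
    simp only [Fin.cons_succ]
    exact (hu l).symm

variable [FiniteDimensional ℝ V]

/-- `L(x)` is self-adjoint on the span of the powers of `x`, so `1 = x ^ 0` splits there into
eigenvectors. These components will be the spectral idempotents. -/
theorem IsAssocForm.exists_one_eq_sum {B : LinearMap.BilinForm ℝ V} (hB : IsAssocForm B) (x : V) :
    ∃ f : ℝ →₀ V, (∀ μ, f μ ∈ operatorCommutant x) ∧ (∀ μ, x * f μ = μ • f μ) ∧
      (f.sum fun _ y => y) = 1 := by
  set S := Submodule.span ℝ (Set.range (jpow x))
  let A : Module.End ℝ S := (LinearMap.mulLeft ℝ x).restrict fun y hy => mul_mem_span_jpow x hy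
  have hA : ∀ y : S, ((A y : S) : V) = x * y := fun y => rfl
  have htop := iSup_eigenspace_eq_top_of_selfAdjoint (B.restrict S)
    (fun y z => hB.symm y z)
    (fun y hy => hB.pos y fun h => hy (Subtype.ext h)) A
    (fun y z => hB.mul_left x y z)
  have h1 : (1 : V) ∈ S := Submodule.subset_span ⟨0, rfl⟩
  have hmem : (⟨1, h1⟩ : S) ∈ ⨆ μ, A.eigenspace μ := htop ▸ Submodule.mem_top
  obtain ⟨f, hf, hsum⟩ := (Submodule.mem_iSup_iff_exists_finsupp _ _).mp hmem
  refine ⟨f.mapRange S.subtype (map_zero _), fun μ => ?_, fun μ => ?_, ?_⟩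
  · rw [Finsupp.mapRange_apply]
    exact span_jpow_le_operatorCommutant x (f μ).2
  · rw [Finsupp.mapRange_apply]
    have := congrArg S.subtype (Module.End.mem_eigenspace_iff.mp (hf μ))
    simpa [hA] using this
  · rw [Finsupp.sum_mapRange_index (fun _ => rfl)]
    have := congrArg S.subtype hsum
    simpa [Finsupp.sum] using this

/-- The spectral theorem, with idempotents that are polynomials in `x`. -/
theorem exists_completeSystem (x : V) :
    ∃ (n : ℕ) (c : Fin n → V) (l : Fin n → ℝ), IsCompleteSystem c ∧ x = ∑ i, l i • c i := by
  obtain ⟨B, hB⟩ := exists_assocForm V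
  obtain ⟨f, hf, hx, hsum⟩ := hB.exists_one_eq_sum x
  -- Since `L(f μ)` and `L(f ν)` commute with `L(x)`, the product satisfies the eigenvector equation
  -- for both `μ` and `ν`.
  have horth : ∀ μ ν, μ ≠ ν → f μ * f ν = 0 := by
    intro μ ν hne
    have h1 : x * (f μ * f ν) = ν • (f μ * f ν) := by
      rw [← hf μ, hx, mul_smul_comm]
    have h2 : x * (f μ * f ν) = μ • (f μ * f ν) := by
      rw [mul_comm (f μ), ← hf ν, hx, mul_smul_comm]
    have h3 : (μ - ν) • (f μ * f ν) = 0 := by rw [sub_smul, ← h1, ← h2, sub_self]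
    exact (smul_eq_zero.mp h3).resolve_left (sub_ne_zero.mpr hne)
  have hidem : ∀ μ, f μ * f μ = f μ := by
    intro μ
    have h : f μ * (f.sum fun _ y => y) = f μ := by rw [hsum, mul_one]
    rw [Finsupp.sum, Finset.mul_sum, Finset.sum_eq_single μ] at h
    · exact h
    · exact fun ν _ hne => horth μ ν hne.symm
    · intro hμ
      rw [Finsupp.notMem_support_iff.mp hμ, mul_zero]
  let e := f.support.equivFin.symm
  have hres : ∀ g : ℝ → V, ∑ i, g (e i) = ∑ μ ∈ f.support, g μ := by
    intro g
    rw [← Finset.sum_coe_sort f.support]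
    exact e.sum_comp fun μ : f.support => g μ
  refine ⟨_, fun i => f (e i), fun i => (e i : ℝ),
    ⟨fun i => ?_, fun i => hidem _, fun i j hij => ?_, ?_⟩, ?_⟩
  · exact Finsupp.mem_support_iff.mp (e i).2
  · exact horth _ _ fun h => hij (e.injective (Subtype.ext h))
  · rw [hres f]
    exact hsum
  · rw [hres fun μ => μ • f μ]
    simp only [← hx]
    rw [← Finset.mul_sum]
    exact (mul_one x).symm.trans (congrArg (x * ·) hsum.symm)

/-- The spectral theorem: every element is a linear combination of a Jordan frame. -/
theorem exists_jordanFrame (x : V) :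
    ∃ (n : ℕ) (c : Fin n → V) (l : Fin n → ℝ), IsJordanFrame c ∧ x = ∑ i, l i • c i := by
  classical
  let p : ℕ → Prop := fun n =>
    ∃ (c : Fin n → V) (l : Fin n → ℝ), IsCompleteSystem c ∧ x = ∑ i, l i • c i
  obtain ⟨n₀, hn₀⟩ := exists_completeSystem x
  have hle : ∀ n, p n → n ≤ Module.finrank ℝ V := by
    rintro n ⟨c, l, hc, -⟩
    exact hc.le_finrank
  -- A longest complete system admits no refinement, so its members are primitive.
  have hmax : p (Nat.findGreatest p (Module.finrank ℝ V)) :=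
    Nat.findGreatest_spec (hle n₀ hn₀) hn₀
  set n := Nat.findGreatest p (Module.finrank ℝ V) with hn
  obtain ⟨c, l, hc, hx⟩ := hmax
  refine ⟨n, c, l, ⟨fun i => ⟨hc.ne_zero i, hc.idem i, ?_⟩, hc.orthogonal, hc.sum_eq_one⟩, hx⟩
  rintro ⟨a, b, ha, hb, ha', hb', hab⟩
  obtain ⟨c', l', hc', hl'⟩ := hc.exists_refinement ha hb ha' hb' hab l
  have hp : p (n + 1) := ⟨c', l', hc', hx.trans hl'⟩
  have := Nat.le_findGreatest (hle _ hp) hp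
  omega

end Spectral

/-! ### Linearity of the trace; size of Jordan frames -/

section Trace

variable {V : Type*} [NonAssocCommRing V] [Module ℝ V] [IsEuclideanJordanAlgebra V]
  [FiniteDimensional ℝ V]

/-- `B (1 - c) (x * x) = 0` is a sum of nonnegative terms, so each frame idempotent `d i` with `l i
≠ 0` satisfies `c * d i = d i`. Then `c = d i + (c - d i)` splits `c` unless `d i = c`. -/
theorem exists_eq_smul_of_primitive {c : V} (hc : IsPrimitiveIdempotent c) {x : V}
    (hx : c * x = x) : ∃ r : ℝ, x = r • c := by
  obtain ⟨n, d, l, hd, hxd⟩ := exists_jordanFrame x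
  have hs := hd.isCompleteSystem
  have hdi : ∀ i, l i ≠ 0 → c * d i = d i := by
    obtain ⟨B, hB⟩ := exists_assocForm V
    have hc' : (1 - c) * (1 - c) = 1 - c := by
      rw [mul_sub, mul_one, sub_mul, one_mul, hc.2.1, sub_self, sub_zero]
    have e : ∀ i, B ((1 - c) * d i) (d i) = B (1 - c) (d i) := fun i => by
      rw [hB.assoc, hs.idem]
    have h0 : ∑ i, l i * l i * B (1 - c) (d i) = 0 := by
      have h : B (1 - c) (x * x) = 0 := by
        rw [← hB.assoc, sub_mul, one_mul, hx, sub_self, map_zero, LinearMap.zero_apply]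
      rw [hxd, hs.sum_mul_sum, map_sum] at h
      simpa using h
    rw [Finset.sum_eq_zero_iff_of_nonneg fun i _ => mul_nonneg (mul_self_nonneg _)
      (e i ▸ hB.idempotent_mul_nonneg hc' (d i))] at h0
    intro i hi
    have h1 := (mul_eq_zero.mp (h0 i (Finset.mem_univ i))).resolve_left (mul_self_ne_zero.mpr hi)
    have h2 := hB.idempotent_mul_eq_zero hc' ((e i).trans h1)
    rw [sub_mul, one_mul, sub_eq_zero] at h2
    exact h2.symm
  have hdc : ∀ i, l i ≠ 0 → d i = c := by
    intro i hi
    by_contra hne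
    refine hc.2.2 ⟨d i, c - d i, hs.idem i, ?_, hne, ?_, by abel⟩
    · rw [mul_sub, sub_mul, sub_mul, hc.2.1, hs.idem, mul_comm _ c, hdi i hi]
      abel
    · intro h
      exact hs.ne_zero i (sub_eq_self.mp h)
  refine ⟨∑ i, l i, ?_⟩
  rw [Finset.sum_smul]
  refine hxd.trans (Finset.sum_congr rfl fun i _ => ?_)
  rcases eq_or_ne (l i) 0 with h | h
  · rw [h, zero_smul, zero_smul]
  · rw [hdc i h]

namespace IsAssocForm

variable {B : LinearMap.BilinForm ℝ V}

/-- The quadratic representation of a primitive idempotent is a rank-one projection. -/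
theorem quadratic_primitive (hB : IsAssocForm B) {c : V} (hc : IsPrimitiveIdempotent c) (x : V) :
    (2 : ℝ) • (c * (c * x)) - c * x = (B c x / B c c) • c := by
  have h : c * ((2 : ℝ) • (c * (c * x)) - c * x) = (2 : ℝ) • (c * (c * x)) - c * x := by
    rw [mul_sub, mul_smul_comm, peirce_cubic hc.2.1]
    module
  obtain ⟨r, hr⟩ := exists_eq_smul_of_primitive hc h
  have hpos := hB.pos c hc.1
  have h2 := congrArg (B c) hr
  have h3 : B c (c * x) = B c x := by rw [← hB.assoc, hc.2.1]
  have h4 : B c (c * (c * x)) = B c x := by rw [← hB.assoc, hc.2.1, h3]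
  rw [map_sub, map_smul, map_smul, h3, h4, smul_eq_mul, smul_eq_mul] at h2
  rw [hr, ← (eq_div_iff hpos.ne').mpr (show r * B c c = B c x by linarith)]

/-- Pairing the rank-one formula for `c` at `d` with `d`, and the one for `d` at `c` with `c`, gives
the same number `2 B (cd) (cd) - B c d`; hence `B c d ^ 2 / B c c = B c d ^ 2 / B d d`. -/
theorem norm_primitive_eq (hB : IsAssocForm B) {c d : V} (hc : IsPrimitiveIdempotent c)
    (hd : IsPrimitiveIdempotent d) (hcd : B c d ≠ 0) : B c c = B d d := by
  have h1 := congrArg (B d) (hB.quadratic_primitive hc d)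
  have h2 := congrArg (B c) (hB.quadratic_primitive hd c)
  have e : ∀ a b : V, B a (b * (b * a)) = B (b * a) (b * a) := fun a b => by
    rw [← hB.assoc, mul_comm a b]
  have e1 : B d (c * d) = B c d := by rw [mul_comm, ← hB.assoc, hd.2.1, hB.symm]
  have e2 : B c (d * c) = B c d := by rw [mul_comm, ← hB.assoc, hc.2.1]
  rw [map_sub, map_smul, map_smul, e, e1, hB.symm d c, smul_eq_mul, smul_eq_mul] at h1
  rw [map_sub, map_smul, map_smul, e, e2, hB.symm d c, mul_comm d c, smul_eq_mul, smul_eq_mul] at h2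
  have hc0 := hB.pos c hc.1
  have hd0 := hB.pos d hd.1
  have h3 : B c d / B c c * B c d = B c d / B d d * B c d := by linarith
  have h4 := mul_right_cancel₀ hcd h3
  rw [div_eq_div_iff hc0.ne' hd0.ne'] at h4
  exact (mul_left_cancel₀ hcd h4).symm

end IsAssocForm

variable (V) in
/-- There is a linear functional that is `1` on all primitive idempotents. -/
theorem exists_linear_trace :
    ∃ τ : V →ₗ[ℝ] ℝ, ∀ c, IsPrimitiveIdempotent c → τ c = 1 := by
  obtain ⟨B, hB⟩ := exists_assocForm V
  obtain ⟨n, d, l, hd, -⟩ := exists_jordanFrame (1 : V)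
  -- On a primitive `c`, each weight that matters equals `(B c c)⁻¹`, so the sum is `B 1 c / B c c =
  -- 1`.
  refine ⟨∑ i, (B (d i) (d i))⁻¹ • B (d i), fun c hc => ?_⟩
  have hc0 := hB.pos c hc.1
  have h : ∀ i, ((B (d i) (d i))⁻¹ • B (d i)) c = (B c c)⁻¹ * B (d i) c := by
    intro i
    rw [LinearMap.smul_apply, smul_eq_mul]
    rcases eq_or_ne (B (d i) c) 0 with h0 | h0
    · rw [h0, mul_zero, mul_zero]
    · rw [hB.norm_primitive_eq (hd.primitive i) hc h0]
  rw [LinearMap.sum_apply, Finset.sum_congr rfl fun i _ => h i, ← Finset.mul_sum,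
    ← LinearMap.sum_apply, ← map_sum, hd.sum_eq_one]
  have h1 : B 1 c = B c c := by
    conv_lhs => rw [← hc.2.1]
    rw [← hB.assoc, one_mul]
  rw [h1, inv_mul_cancel₀ hc0.ne']

variable (V) in
/-- The trace as a linear functional. -/
noncomputable def traceForm : V →ₗ[ℝ] ℝ := (exists_linear_trace V).choose

theorem traceForm_primitive {c : V} (hc : IsPrimitiveIdempotent c) : traceForm V c = 1 :=
  (exists_linear_trace V).choose_spec c hc

theorem IsJordanFrame.traceForm_sum {n : ℕ} {c : Fin n → V} (hc : IsJordanFrame c)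
    (l : Fin n → ℝ) : traceForm V (∑ i, l i • c i) = ∑ i, l i := by
  rw [map_sum]
  refine Finset.sum_congr rfl fun i _ => ?_
  rw [map_smul, traceForm_primitive (hc.primitive i), smul_eq_mul, mul_one]

theorem IsJordanFrame.card_eq_traceForm_one {n : ℕ} {c : Fin n → V} (hc : IsJordanFrame c) :
    (n : ℝ) = traceForm V 1 := by
  have h := hc.traceForm_sum fun _ => 1
  simp only [one_smul, hc.sum_eq_one] at h
  simp [h]

/-- All frames have `traceForm V 1` members, so the powers of any `x` lie in a span of `n` vectors.
Conversely, distinct eigenvalues make the first `n` powers independent (Vandermonde). -/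
theorem IsJordanFrame.card_eq_rank {n : ℕ} {c : Fin n → V} (hc : IsJordanFrame c) :
    n = rank V := by
  have hmem : ∀ x : V, ¬ LinearIndependent ℝ (fun k : Fin (n + 1) => jpow x k) := by
    intro x hli
    obtain ⟨m, d, l, hd, hx⟩ := exists_jordanFrame x
    have hm : m = n := by
      exact_mod_cast hd.card_eq_traceForm_one.trans hc.card_eq_traceForm_one.symm
    subst hm
    have hle : Submodule.span ℝ (Set.range fun k : Fin (m + 1) => jpow x k) ≤
        Submodule.span ℝ (Set.range d) := by
      rw [Submodule.span_le]
      rintro _ ⟨k, rfl⟩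
      rw [hx]
      simp only [hd.isCompleteSystem.jpow_sum]
      exact Submodule.sum_mem _ fun i _ => Submodule.smul_mem _ _ (Submodule.subset_span ⟨i, rfl⟩)
    have h1 := Submodule.finrank_mono hle
    rw [finrank_span_eq_card hli, Fintype.card_fin] at h1
    have h2 := finrank_range_le_card (R := ℝ) d
    rw [Fintype.card_fin] at h2
    have h3 : m + 1 ≤ m := h1.trans h2
    omega
  refine le_antisymm ?_ (Nat.sInf_le hmem)
  refine le_csInf ⟨n, hmem⟩ fun r hr => ?_
  by_contra! hlt
  refine hr (∑ i : Fin n, ((i : ℕ) : ℝ) • c i) ?_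
  have hs := hc.isCompleteSystem
  rw [Fintype.linearIndependent_iff]
  intro g hg
  refine congrFun (Matrix.eq_zero_of_forall_index_sum_mul_pow_eq_zero
    (f := fun j : Fin (r + 1) => ((j : ℕ) : ℝ)) (v := g) (fun a b h => ?_) fun j => ?_)
  · exact Fin.ext (Nat.cast_injective h)
  · simp only [hs.jpow_sum, Finset.smul_sum, smul_smul] at hg
    rw [Finset.sum_comm] at hg
    simp only [← Finset.sum_smul] at hg
    exact Fintype.linearIndependent_iff.mp hs.linearIndependent _ hg
      ⟨j, by omega⟩

theorem exists_spectralDecomposition (x : V) : ∃ l c, IsSpectralDecomposition x l c := by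
  obtain ⟨n, c, l, hc, hx⟩ := exists_jordanFrame x
  obtain rfl := hc.card_eq_rank
  exact ⟨l, c, hc, hx⟩

/-- Frees the trace from the chosen decomposition: the functional has the same value on every one.
-/
theorem trace_eq_traceForm (x : V) : trace x = traceForm V x := by
  have h := exists_spectralDecomposition x
  obtain ⟨c, hc, hx⟩ := h.choose_spec
  rw [trace, eigenvalues, dif_pos h, ← hc.traceForm_sum, ← hx]

theorem ip_eq_traceForm (x y : V) : ip x y = traceForm V (x * y) := trace_eq_traceForm _

theorem traceForm_mul_self_nonneg (x : V) : 0 ≤ traceForm V (x * x) := by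
  obtain ⟨n, c, l, hc, hx⟩ := exists_jordanFrame x
  rw [hx, hc.isCompleteSystem.sum_mul_sum, hc.traceForm_sum]
  exact Finset.sum_nonneg fun i _ => mul_self_nonneg _

theorem frobNorm_sq (x : V) : frobNorm x ^ 2 = traceForm V (x * x) := by
  rw [frobNorm, ip_eq_traceForm, Real.sq_sqrt (traceForm_mul_self_nonneg x)]

end Trace

/-! ### Interior of the cone of squares, the spectraplex, and the descent estimate -/

section Scheme

variable {V : Type*} [NonAssocCommRing V] [Module ℝ V] [IsEuclideanJordanAlgebra V]

theorem IsJordanFrame.isSquare {n : ℕ} {c : Fin n → V} (hc : IsJordanFrame c) {l : Fin n → ℝ}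
    (hl : ∀ i, 0 ≤ l i) : ∃ x : V, ∑ i, l i • c i = x * x := by
  refine ⟨∑ i, √(l i) • c i, ?_⟩
  rw [hc.isCompleteSystem.sum_mul_sum]
  exact Finset.sum_congr rfl fun i _ => by rw [Real.mul_self_sqrt (hl i)]

namespace IsAssocForm

variable {B : LinearMap.BilinForm ℝ V}

theorem coeff_nonneg (hB : IsAssocForm B) {n : ℕ} {c : Fin n → V} (hc : IsJordanFrame c)
    {l : Fin n → ℝ} (h : ∀ d : V, d * d = d → 0 ≤ B d (∑ i, l i • c i)) (i : Fin n) :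
    0 ≤ l i := by
  have hs := hc.isCompleteSystem
  have h1 := h (c i) (hs.idem i)
  rw [← hs.idem i, hB.assoc, hs.mul_sum, map_smul, smul_eq_mul] at h1
  exact nonneg_of_mul_nonneg_left h1 (hB.pos _ (hs.ne_zero i))

variable [FiniteDimensional ℝ V]

/-- The cone of squares is cut out by the idempotents. -/
theorem isSquare_iff (hB : IsAssocForm B) (y : V) :
    (∃ x : V, y = x * x) ↔ ∀ d : V, d * d = d → 0 ≤ B d y := by
  constructor
  · rintro ⟨x, rfl⟩ d hd
    rw [← hB.assoc]
    exact hB.idempotent_mul_nonneg hd x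
  · intro h
    obtain ⟨n, c, l, hc, rfl⟩ := exists_jordanFrame y
    exact hc.isSquare (hB.coeff_nonneg hc h)

end IsAssocForm

variable [FiniteDimensional ℝ V]

theorem IsOrthogonalProjection.traceForm_mul {L : Submodule ℝ V} {P : V →ₗ[ℝ] V}
    (hP : IsOrthogonalProjection L P) (x z : V) :
    traceForm V (P x * P z) = traceForm V (x * P z) := by
  have h := (hP x).2 (P z) (hP z).1
  rw [ip_eq_traceForm, sub_mul, map_sub, sub_eq_zero] at h
  exact h.symm

theorem IsOrthogonalProjection.traceForm_mul_self_le {L : Submodule ℝ V} {P : V →ₗ[ℝ] V}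
    (hP : IsOrthogonalProjection L P) (x : V) :
    traceForm V (P x * P x) ≤ traceForm V (x * x) := by
  have h := traceForm_mul_self_nonneg (x - P x)
  rw [sub_mul, mul_sub, mul_sub, map_sub, map_sub, map_sub, mul_comm (P x) x,
    ← hP.traceForm_mul x x] at h
  linarith

variable [TopologicalSpace V] [IsTopologicalAddGroup V] [ContinuousSMul ℝ V] [T2Space V]

/-- Continuity of the product is not assumed; coordinates are continuous in finite dimension. -/
theorem continuous_traceForm_mul_self : Continuous fun y : V => traceForm V (y * y) := by
  let b := Module.finBasis ℝ V
  have h : ∀ y : V, traceForm V (y * y) =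
      ∑ i, ∑ j, b.repr y i * (b.repr y j * traceForm V (b i * b j)) := by
    intro y
    conv_lhs => rw [← b.sum_repr y]
    rw [Finset.sum_mul, map_sum]
    refine Finset.sum_congr rfl fun i _ => ?_
    rw [Finset.mul_sum, map_sum]
    refine Finset.sum_congr rfl fun j _ => ?_
    rw [smul_mul_assoc, mul_smul_comm, map_smul, map_smul, smul_eq_mul, smul_eq_mul]
  have hcont : ∀ i, Continuous fun y : V => b.repr y i := fun i =>
    (b.coord i).continuous_of_finiteDimensional
  simp only [h]
  fun_prop

/-- If `δ > 0` bounds the eigenvalues of `x` below, the open Frobenius ball of radius `δ` about `x`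
consists of squares: `y = (δ • 1 + (y - x)) + (x - δ • 1)` has both summands in the cone, which is
closed under addition by `isSquare_iff`. -/
theorem IsJordanFrame.mem_coneInt {n : ℕ} {c : Fin n → V} (hc : IsJordanFrame c)
    {l : Fin n → ℝ} (hl : ∀ i, 0 < l i) : ∑ i, l i • c i ∈ coneInt V := by
  obtain ⟨B, hB⟩ := exists_assocForm V
  obtain ⟨δ, hδ, hδl⟩ : ∃ δ : ℝ, 0 < δ ∧ ∀ i, δ ≤ l i := by
    rcases isEmpty_or_nonempty (Fin n) with h | h
    · exact ⟨1, one_pos, fun i => h.elim i⟩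
    · obtain ⟨i, hi⟩ := Finite.exists_min l
      exact ⟨l i, hl i, hi⟩
  set x := ∑ i, l i • c i with hx
  rw [coneInt, mem_interior]
  refine ⟨{y | traceForm V ((y - x) * (y - x)) < δ ^ 2}, fun y hy => ?_, ?_, ?_⟩
  · obtain ⟨m, d, k, hd, hk⟩ := exists_jordanFrame (y - x)
    have hy' : ∑ j, k j * k j < δ ^ 2 := by
      rw [← hd.traceForm_sum, ← hd.isCompleteSystem.sum_mul_sum, ← hk]
      exact hy
    have hkδ : ∀ j, 0 ≤ δ + k j := by
      intro j
      have h1 := Finset.single_le_sum (fun i _ => mul_self_nonneg (k i)) (Finset.mem_univ j)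
      have h2 : k j ^ 2 < δ ^ 2 := by rw [pow_two]; exact h1.trans_lt hy'
      linarith [neg_lt_of_abs_lt (abs_lt_of_sq_lt_sq h2 hδ.le)]
    have s1 := (hB.isSquare_iff _).mp (hd.isSquare hkδ)
    have s2 := (hB.isSquare_iff _).mp (hc.isSquare fun i => sub_nonneg.mpr (hδl i))
    refine (hB.isSquare_iff y).mpr fun e he => ?_
    have h : y = ∑ j, (δ + k j) • d j + ∑ i, (l i - δ) • c i := by
      simp only [add_smul, sub_smul, Finset.sum_add_distrib, Finset.sum_sub_distrib,
        ← Finset.smul_sum, hc.sum_eq_one, hd.sum_eq_one, ← hx, ← hk]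
      abel
    rw [h, map_add]
    exact add_nonneg (s1 e he) (s2 e he)
  · exact isOpen_lt (continuous_traceForm_mul_self.comp (continuous_id.sub continuous_const))
      continuous_const
  · simpa using pow_pos hδ 2

theorem IsJordanFrame.mem_closure_coneInt {n : ℕ} {c : Fin n → V} (hc : IsJordanFrame c)
    (i : Fin n) : c i ∈ closure (coneInt V) := by
  have hcont : Continuous fun ε : ℝ => c i + ε • (1 : V) := by fun_prop
  have ht : Filter.Tendsto (fun ε : ℝ => c i + ε • (1 : V)) (nhdsWithin 0 (Set.Ioi 0))
      (nhds (c i)) := by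
    simpa using (hcont.tendsto 0).mono_left nhdsWithin_le_nhds
  refine mem_closure_of_tendsto ht (eventually_nhdsWithin_of_forall fun ε (hε : 0 < ε) => ?_)
  have h : c i + ε • (1 : V) = ∑ j, ((Pi.single i 1 : Fin n → ℝ) j + ε) • c j := by
    simp only [add_smul, Finset.sum_add_distrib, ← Finset.smul_sum, hc.sum_eq_one]
    simp [Pi.single_apply]
  rw [h]
  refine hc.mem_coneInt fun j => add_pos_of_nonneg_of_pos ?_ hε
  rw [Pi.single_apply]
  split_ifs <;> norm_num

theorem exists_mem_spectraplex_ip_nonpos {y : V} (hy : y ∉ coneInt V) :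
    ∃ w ∈ spectraplex V, ip w y ≤ 0 := by
  obtain ⟨n, c, l, hc, rfl⟩ := exists_jordanFrame y
  obtain ⟨i, hi⟩ : ∃ i, l i ≤ 0 := by
    by_contra! h
    exact hy (hc.mem_coneInt h)
  refine ⟨c i, ⟨hc.mem_closure_coneInt i, ?_⟩, ?_⟩
  · rw [ip_eq_traceForm, one_mul, traceForm_primitive (hc.primitive i)]
  · rw [ip_eq_traceForm, hc.isCompleteSystem.mul_sum, map_smul,
      traceForm_primitive (hc.primitive i), smul_eq_mul, mul_one]
    exact hi

theorem IsAssocForm.nonneg_of_mem_closure_coneInt {B : LinearMap.BilinForm ℝ V}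
    (hB : IsAssocForm B) {x : V} (hx : x ∈ closure (coneInt V)) {d : V} (hd : d * d = d) :
    0 ≤ B d x := by
  have hclosed : IsClosed {y : V | 0 ≤ B d y} :=
    isClosed_le continuous_const (B d).continuous_of_finiteDimensional
  refine closure_minimal (fun y hy => ?_) hclosed hx
  exact (hB.isSquare_iff y).mp (interior_subset (s := {y : V | ∃ x : V, y = x * x}) hy) d hd

/-- The eigenvalues are nonnegative with sum `1`, so their squares sum to at most `1`. -/
theorem traceForm_mul_self_le_one_of_mem_spectraplex {x : V} (hx : x ∈ spectraplex V) :
    traceForm V (x * x) ≤ 1 := by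
  obtain ⟨B, hB⟩ := exists_assocForm V
  obtain ⟨h1, h2⟩ := hx
  obtain ⟨n, c, l, hc, rfl⟩ := exists_jordanFrame x
  have hl := hB.coeff_nonneg hc fun d hd => hB.nonneg_of_mem_closure_coneInt h1 hd
  rw [ip_eq_traceForm, one_mul, hc.traceForm_sum] at h2
  rw [hc.isCompleteSystem.sum_mul_sum, hc.traceForm_sum, ← h2]
  refine Finset.sum_le_sum fun i _ => mul_le_of_le_one_left (hl i) ?_
  rw [← h2]
  exact Finset.single_le_sum (fun j _ => hl j) (Finset.mem_univ i)

/-- One step of the scheme increases `‖P z‖⁻²` by at least one. -/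
theorem VonNeumannIterate.mul_frobNorm_sq_le_one {L : Submodule ℝ V} {P : V →ₗ[ℝ] V}
    (hP : IsOrthogonalProjection L P) {u : V → V} (hu : IsLinearMinimizationOracle u) {t : ℕ}
    {z : V} (hz : VonNeumannIterate P u t z) : (t : ℝ) * frobNorm (P z) ^ 2 ≤ 1 := by
  induction hz with
  | init z₀ h => simp
  | step t z θ _ hc hθ ih =>
    obtain ⟨w, hw, hwle⟩ := exists_mem_spectraplex_ip_nonpos hc.1
    obtain ⟨hus, hmin⟩ := hu (P z)
    have hb : traceForm V (P (u (P z)) * P z) ≤ 0 := by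
      rw [hP.traceForm_mul, ← ip_eq_traceForm]
      exact (hmin w hw).trans hwle
    have hd : traceForm V (P (u (P z)) * P (u (P z))) ≤ 1 :=
      (hP.traceForm_mul_self_le _).trans (traceForm_mul_self_le_one_of_mem_spectraplex hus)
    set a := frobNorm (P z) ^ 2 with ha
    have ha0 : 0 ≤ a := sq_nonneg _
    have ha' : traceForm V (P z * P z) = a := (frobNorm_sq _).symm
    have hη0 : 0 ≤ a / (1 + a) := by positivity
    have hη1 : a / (1 + a) ≤ 1 := (div_le_one (by linarith)).mpr (by linarith)
    -- The comparison step minimizes `(1 - η)² a + η²`, the bound left after dropping the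
    -- nonpositive cross term.
    have h := hθ.2 (a / (1 + a)) ⟨hη0, hη1⟩
    have e : ∀ η : ℝ, frobNorm (P (z + η • (u (P z) - z))) ^ 2 = (1 - η) ^ 2 * a +
        2 * (η * (1 - η)) * traceForm V (P (u (P z)) * P z) +
        η ^ 2 * traceForm V (P (u (P z)) * P (u (P z))) := by
      intro η
      have hlin : P (z + η • (u (P z) - z)) = (1 - η) • P z + η • P (u (P z)) := by
        rw [map_add, map_smul, map_sub]
        module
      rw [frobNorm_sq, hlin, add_mul, mul_add, mul_add]
      simp only [smul_mul_assoc, mul_smul_comm, map_add, map_smul, smul_eq_mul,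
        mul_comm (P z) (P (u (P z))), ha']
      ring
    have hbound : frobNorm (P (z + θ • (u (P z) - z))) ^ 2 ≤ a / (1 + a) := by
      refine h.trans ?_
      rw [e]
      have h1 : 2 * (a / (1 + a) * (1 - a / (1 + a))) * traceForm V (P (u (P z)) * P z) ≤ 0 :=
        mul_nonpos_of_nonneg_of_nonpos
          (mul_nonneg zero_le_two (mul_nonneg hη0 (sub_nonneg.mpr hη1))) hb
      have h2 := mul_le_mul_of_nonneg_left hd (sq_nonneg (a / (1 + a)))
      have h3 : (1 - a / (1 + a)) ^ 2 * a + (a / (1 + a)) ^ 2 = a / (1 + a) := by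
        field_simp
        ring
      linarith
    calc ((t + 1 : ℕ) : ℝ) * frobNorm (P (z + θ • (u (P z) - z))) ^ 2
        ≤ ((t + 1 : ℕ) : ℝ) * (a / (1 + a)) := by gcongr
      _ = (t * a + a) / (1 + a) := by push_cast; ring
      -- The induction hypothesis `t * a ≤ 1` enters here.
      _ ≤ 1 := (div_le_one (by linarith)).mpr (by linarith)

end Scheme

end EuclideanJordan

theorem mainTheorem9 {V : Type*} [NonAssocCommRing V] [Module ℝ V] [FiniteDimensional ℝ V]
    [EuclideanJordan.IsEuclideanJordanAlgebra V]
    [TopologicalSpace V] [IsTopologicalAddGroup V] [ContinuousSMul ℝ V] [T2Space V]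
    (L : Submodule ℝ V) (P : V →ₗ[ℝ] V) (hP : EuclideanJordan.IsOrthogonalProjection L P)
    (u : V → V) (hu : EuclideanJordan.IsLinearMinimizationOracle u)
    (t : ℕ) (ht : 1 ≤ t) (z : V) (hz : EuclideanJordan.VonNeumannIterate P u t z) :
    EuclideanJordan.frobNorm (P z) ^ 2 ≤ 1 / (t : ℝ) := by
  have ht' : (0 : ℝ) < t := by exact_mod_cast ht
  rw [le_div_iff₀ ht', mul_comm]
  exact hz.mul_frobNorm_sq_le_one hP hu
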